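/- Let $M$ be a smooth finite-dimensional (Hausdorff) manifold. A bivector on $M$ is a smooth skew-symmetric contravariant tensor field of rank two, identified with the corresponding skew-symmetric operator $T^*M\to TM$; it is nondegenerate if this operator has trivial kernel at every point. The Schouten bracket of bivectors $H,K$ is $$[H,K](\xi_1,\xi_2,\xi_3)=\langle H L_{K\xi_1}\xi_2,\xi_3\rangle+\langle K L_{H\xi_1}\xi_2,\xi_3\rangle+\mathrm{cycle}(1,2,3)$$ for smooth one-forms $\xi_1,\xi_2,\xi_3$, where $L$ denotes the Lie derivative. A bivector $P$ is Poisson if $[P,P]=0$, and two Poisson bivectors are compatible if every linear combination of them with constant coefficients is again Poisson. Let $P$ and $\tilde P$ be Poisson bivectors on $M$ with $P$ nondegenerate, and suppose that there is a smooth vector field $\tau_0$ on $M$ such that $L_{\tau_0}(P)=\mu P$ and $L_{\tau_0}(\tilde P)=\nu\tilde P$ for some real constants $\mu,\nu$ with $\mu\neq\nu/2$. Then $P$ and $\tilde P$ are compatible if and only if $$L_{R\tau_0}(P)=(2\mu-\nu)\tilde P,\qquad\text{where } R=\tilde P P^{-1}.$$ -/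

import Mathlib

open scoped Manifold ContDiff

namespace PoissonGeometry

open Bundle

noncomputable section

variable {E : Type*} [NormedAddCommGroup E] [NormedSpace ℝ E]
  {M : Type*} [TopologicalSpace M] [ChartedSpace E M]

variable (E) in
/-- The cotangent space of `M` at `x`. -/
abbrev Cotangent (x : M) : Type _ := TangentSpace 𝓘(ℝ, E) x →L[ℝ] ℝ

variable (E M) in
/-- (Not necessarily smooth) vector fields on `M`. -/
abbrev VecField : Type _ := Π x : M, TangentSpace 𝓘(ℝ, E) x

variable (E M) in
/-- (Not necessarily smooth) one-forms on `M`. -/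
abbrev OneForm : Type _ := Π x : M, Cotangent E x

variable (E M) in
/-- (Not necessarily smooth or skew) contravariant tensor fields of rank two on `M`, seen as
operators `B : T*M → TM`; as a tensor, `B (α, β) = α (B β)`. -/
abbrev TensorField : Type _ := Π x : M, Cotangent E x →L[ℝ] TangentSpace 𝓘(ℝ, E) x

/-- `B` is nondegenerate if all the operators `B x : T*ₓM → TₓM` have trivial kernel. -/
def Nondegenerate (B : TensorField E M) : Prop :=
  ∀ (x : M) (α : Cotangent E x), B x α = 0 → α = 0

/-- A nondegenerate tensor field of rank two is pointwise invertible. -/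
theorem Nondegenerate.isInvertible [FiniteDimensional ℝ E] {B : TensorField E M} (hB : Nondegenerate B) (x : M) :
    (B x).IsInvertible := by
  have hE : FiniteDimensional ℝ (TangentSpace 𝓘(ℝ, E) x) := inferInstanceAs (FiniteDimensional ℝ E)
  have ht : T2Space (TangentSpace 𝓘(ℝ, E) x) := inferInstanceAs (T2Space E)
  have hinj : Function.Injective (B x : Cotangent E x →ₗ[ℝ] TangentSpace 𝓘(ℝ, E) x) := by
    rw [injective_iff_map_eq_zero]
    exact hB x
  have hdim : Module.finrank ℝ (Cotangent E x) = Module.finrank ℝ (TangentSpace 𝓘(ℝ, E) x) := by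
    rw [← (LinearMap.toContinuousLinearMap (𝕜 := ℝ) (E := TangentSpace 𝓘(ℝ, E) x)
      (F' := ℝ)).finrank_eq]
    exact Subspace.dual_finrank_eq
  let e := (LinearEquiv.ofInjectiveOfFinrankEq _ hinj hdim).toContinuousLinearEquiv
  exact ⟨e, by ext α; rfl⟩

/-- The field of endomorphisms `R = Q P⁻¹` of the tangent bundle (for nondegenerate `P`). -/
def recursionOperator (P Q : TensorField E M) (x : M) :
    TangentSpace 𝓘(ℝ, E) x →L[ℝ] TangentSpace 𝓘(ℝ, E) x :=
  Q x ∘L (P x).inverse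

section Smoothness

variable [IsManifold 𝓘(ℝ, E) ∞ M]

/-- The vector field `X` is smooth. -/
def VecField.Smooth (X : VecField E M) : Prop :=
  ContMDiff 𝓘(ℝ, E) (𝓘(ℝ, E).prod 𝓘(ℝ, E)) ∞
    (fun x => TotalSpace.mk' E (E := fun x : M => TangentSpace 𝓘(ℝ, E) x) x (X x))

/-- The one-form `ξ` is smooth. -/
def OneForm.Smooth (ξ : OneForm E M) : Prop :=
  ContMDiff 𝓘(ℝ, E) (𝓘(ℝ, E).prod 𝓘(ℝ, E →L[ℝ] ℝ)) ∞
    (fun x => TotalSpace.mk' (E →L[ℝ] ℝ) (E := fun x : M => TangentSpace 𝓘(ℝ, E) x →L[ℝ] ℝ) x (ξ x))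

/-- The one-form `ξ` is differentiable at `x`. -/
def OneForm.DiffAt (ξ : OneForm E M) (x : M) : Prop :=
  MDifferentiableAt 𝓘(ℝ, E) (𝓘(ℝ, E).prod 𝓘(ℝ, E →L[ℝ] ℝ))
    (fun x => TotalSpace.mk' (E →L[ℝ] ℝ) (E := fun x : M => TangentSpace 𝓘(ℝ, E) x →L[ℝ] ℝ) x (ξ x)) x

/-- The rank two tensor field `B` is smooth. -/
def TensorField.Smooth (B : TensorField E M) : Prop :=
  ContMDiff 𝓘(ℝ, E) (𝓘(ℝ, E).prod 𝓘(ℝ, (E →L[ℝ] ℝ) →L[ℝ] E)) ∞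
    (fun x => TotalSpace.mk' ((E →L[ℝ] ℝ) →L[ℝ] E)
      (E := fun x : M => (TangentSpace 𝓘(ℝ, E) x →L[ℝ] ℝ) →L[ℝ] TangentSpace 𝓘(ℝ, E) x) x (B x))

/-- The rank two tensor field `B` is differentiable at `x`. -/
def TensorField.DiffAt (B : TensorField E M) (x : M) : Prop :=
  MDifferentiableAt 𝓘(ℝ, E) (𝓘(ℝ, E).prod 𝓘(ℝ, (E →L[ℝ] ℝ) →L[ℝ] E))
    (fun x => TotalSpace.mk' ((E →L[ℝ] ℝ) →L[ℝ] E)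
      (E := fun x : M => (TangentSpace 𝓘(ℝ, E) x →L[ℝ] ℝ) →L[ℝ] TangentSpace 𝓘(ℝ, E) x) x (B x)) x

end Smoothness

variable [IsManifold 𝓘(ℝ, E) ∞ M]

theorem OneForm.Smooth.diffAt {ξ : OneForm E M} (hξ : ξ.Smooth) (x : M) : ξ.DiffAt x :=
  (hξ x).mdifferentiableAt (by simp)

theorem TensorField.Smooth.diffAt {B : TensorField E M} (hB : B.Smooth) (x : M) : B.DiffAt x :=
  (hB x).mdifferentiableAt (by simp)

theorem diffAt_pairing {ξ : OneForm E M} {Y : VecField E M} {x : M} (hξ : ξ.DiffAt x)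
    (hY : MDiffAt (T% Y) x) : MDiffAt (fun y : M => ξ y (Y y)) x := by
  have := MDifferentiableAt.clm_bundle_apply (E₂ := fun _ : M => ℝ) hξ hY
  rw [mdifferentiableAt_totalSpace] at this
  exact this.2

theorem diffAt_apply {B : TensorField E M} {ξ : OneForm E M} {x : M} (hB : B.DiffAt x)
    (hξ : ξ.DiffAt x) : MDiffAt (T% fun y : M => B y (ξ y)) x :=
  MDifferentiableAt.clm_bundle_apply hB hξ

theorem OneForm.DiffAt.smul {f : M → ℝ} {ξ : OneForm E M} {x : M} (hf : MDiffAt f x)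
    (hξ : ξ.DiffAt x) : OneForm.DiffAt (f • ξ) x :=
  MDifferentiableAt.smul_section hf hξ

theorem OneForm.DiffAt.add {ξ η : OneForm E M} {x : M} (hξ : ξ.DiffAt x) (hη : η.DiffAt x) :
    OneForm.DiffAt (ξ + η) x :=
  mdifferentiableAt_add_section hξ hη

variable [FiniteDimensional ℝ E]

/-- `Y ↦ X (ξ Y) - ξ [X, Y]` is tensorial in `Y`. -/
theorem tensorialAt_lieOneForm (X : VecField E M) {ξ : OneForm E M} {x : M} (hξ : ξ.DiffAt x) :
    TensorialAt 𝓘(ℝ, E) E (fun Y : VecField E M =>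
      mvfderiv 𝓘(ℝ, E) (fun y : M => ξ y (Y y)) x (X x)
        - ξ x (VectorField.mlieBracket 𝓘(ℝ, E) X Y x)) x := by
  have : IsManifold 𝓘(ℝ, E) 2 M := .of_le (n := ∞) ENat.LEInfty.out
  have : CompleteSpace E := FiniteDimensional.complete ℝ E
  constructor
  · intro f Y hf hY
    have h1 := mvfderiv_fun_mul hf (diffAt_pairing hξ hY)
    simp only [Pi.smul_apply', map_smul, smul_eq_mul]
    rw [h1, VectorField.mlieBracket_smul_right hf hY]
    simp
    ring
  · intro Y Z hY hZ
    have h1 := mvfderiv_fun_add (diffAt_pairing hξ hY) (diffAt_pairing hξ hZ)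
    simp only [Pi.add_apply, map_add]
    rw [h1, VectorField.mlieBracket_add_right hY hZ]
    simp
    ring

open Classical in
/-- The Lie derivative `L_X ξ` of a one-form: the one-form determined by
`(L_X ξ)(Y) = X (ξ Y) - ξ [X, Y]` for all vector fields `Y` (see `lieOneForm_apply`);
junk value `0` at the points where `ξ` is not differentiable. -/
def lieOneForm (X : VecField E M) (ξ : OneForm E M) : OneForm E M := fun x =>
  if h : ξ.DiffAt x then TensorialAt.mkHom _ x (tensorialAt_lieOneForm X h) else 0

theorem lieOneForm_apply (X : VecField E M) {ξ : OneForm E M} {Y : VecField E M} {x : M}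
    (hξ : ξ.DiffAt x) (hY : MDiffAt (T% Y) x) :
    lieOneForm X ξ x (Y x) = mvfderiv 𝓘(ℝ, E) (fun y : M => ξ y (Y y)) x (X x)
      - ξ x (VectorField.mlieBracket 𝓘(ℝ, E) X Y x) := by
  rw [lieOneForm, dif_pos hξ]
  exact TensorialAt.mkHom_apply (tensorialAt_lieOneForm X hξ) hY

theorem lieOneForm_smul (X : VecField E M) {f : M → ℝ} {ξ : OneForm E M} {x : M}
    (hf : MDiffAt f x) (hξ : ξ.DiffAt x) :
    lieOneForm X (f • ξ) x = mvfderiv 𝓘(ℝ, E) f x (X x) • ξ x + f x • lieOneForm X ξ x := by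
  ext v
  have hY : MDiffAt (T% (FiberBundle.extend E v : VecField E M)) x :=
    FiberBundle.mdifferentiableAt_extend ..
  have hv : (FiberBundle.extend E v : VecField E M) x = v := by simp
  rw [← hv]
  have h1 := mvfderiv_fun_mul hf (diffAt_pairing hξ hY)
  rw [lieOneForm_apply X (hξ.smul hf) hY]
  simp only [add_apply, smul_apply,
    lieOneForm_apply X hξ hY, Pi.smul_apply', smul_eq_mul]
  rw [h1]
  simp
  ring

theorem lieOneForm_add (X : VecField E M) {ξ η : OneForm E M} {x : M}
    (hξ : ξ.DiffAt x) (hη : η.DiffAt x) :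
    lieOneForm X (ξ + η) x = lieOneForm X ξ x + lieOneForm X η x := by
  ext v
  have hY : MDiffAt (T% (FiberBundle.extend E v : VecField E M)) x :=
    FiberBundle.mdifferentiableAt_extend ..
  have hv : (FiberBundle.extend E v : VecField E M) x = v := by simp
  rw [← hv]
  have h1 := mvfderiv_fun_add (diffAt_pairing hξ hY) (diffAt_pairing hη hY)
  rw [lieOneForm_apply X (hξ.add hη) hY]
  simp only [add_apply,
    lieOneForm_apply X hξ hY, lieOneForm_apply X hη hY, Pi.add_apply]
  rw [h1]
  simp
  ring

/-- `ξ ↦ [X, B ξ] - B (L_X ξ)` is tensorial in `ξ`. -/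
theorem tensorialAt_lieTensor (X : VecField E M) {B : TensorField E M} {x : M} (hB : B.DiffAt x) :
    TensorialAt 𝓘(ℝ, E) (E →L[ℝ] ℝ) (V := fun x : M => TangentSpace 𝓘(ℝ, E) x →L[ℝ] ℝ)
      (fun ξ : OneForm E M =>
        VectorField.mlieBracket 𝓘(ℝ, E) X (fun y => B y (ξ y)) x - B x (lieOneForm X ξ x)) x := by
  have : IsManifold 𝓘(ℝ, E) 2 M := .of_le (n := ∞) ENat.LEInfty.out
  have : CompleteSpace E := FiniteDimensional.complete ℝ E
  constructor
  · intro f ξ hf hξ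
    have h0 : (fun y => B y ((f • ξ) y)) = f • (fun y => B y (ξ y)) := by
      ext y : 1
      simp
    rw [h0, VectorField.mlieBracket_smul_right hf (diffAt_apply hB hξ), lieOneForm_smul X hf hξ]
    simp only [map_add, map_smul]
    module
  · intro ξ η hξ hη
    have h0 : (fun y => B y ((ξ + η) y)) = (fun y => B y (ξ y)) + (fun y => B y (η y)) := by
      ext y : 1
      simp
    rw [h0, VectorField.mlieBracket_add_right (diffAt_apply hB hξ) (diffAt_apply hB hη),
      lieOneForm_add X hξ hη]
    simp only [map_add]
    abel

open Classical in
/-- The Lie derivative `L_X B` of a contravariant tensor field of rank two: the tensor field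
determined by the Leibniz rule `L_X (B ξ) = (L_X B) ξ + B (L_X ξ)`, i.e.
`(L_X B) ξ = [X, B ξ] - B (L_X ξ)`, for all one-forms `ξ` (see `lieTensor_apply`);
junk value `0` at the points where `B` is not differentiable. -/
def lieTensor (X : VecField E M) (B : TensorField E M) : TensorField E M := fun x =>
  if h : B.DiffAt x then TensorialAt.mkHom _ x (tensorialAt_lieTensor X h) else 0

theorem lieTensor_apply (X : VecField E M) {B : TensorField E M} {ξ : OneForm E M} {x : M}
    (hB : B.DiffAt x) (hξ : ξ.DiffAt x) :
    lieTensor X B x (ξ x) =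
      VectorField.mlieBracket 𝓘(ℝ, E) X (fun y => B y (ξ y)) x - B x (lieOneForm X ξ x) := by
  rw [lieTensor, dif_pos hB]
  exact TensorialAt.mkHom_apply (tensorialAt_lieTensor X hB) hξ

/-- The expression `⟨H L_{K ξ₁} ξ₂, ξ₃⟩ + ⟨K L_{H ξ₁} ξ₂, ξ₃⟩`. -/
def schoutenAux (H K : TensorField E M) (ξ₁ ξ₂ ξ₃ : OneForm E M) (x : M) : ℝ :=
  ξ₃ x (H x (lieOneForm (fun y => K y (ξ₁ y)) ξ₂ x))
    + ξ₃ x (K x (lieOneForm (fun y => H y (ξ₁ y)) ξ₂ x))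

/-- The Schouten bracket of two bivectors, evaluated on three one-forms: `[H, K](ξ₁, ξ₂, ξ₃) =
⟨H L_{K ξ₁} ξ₂, ξ₃⟩ + ⟨K L_{H ξ₁} ξ₂, ξ₃⟩ +` cyclic permutations of `(1, 2, 3)`. -/
def schouten (H K : TensorField E M) (ξ₁ ξ₂ ξ₃ : OneForm E M) (x : M) : ℝ :=
  schoutenAux H K ξ₁ ξ₂ ξ₃ x + schoutenAux H K ξ₂ ξ₃ ξ₁ x + schoutenAux H K ξ₃ ξ₁ ξ₂ x

/-- A bivector: a smooth skew-symmetric contravariant tensor field of rank two. -/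
structure IsBivector (B : TensorField E M) : Prop where
  smooth : B.Smooth
  skew : ∀ (x : M) (α β : Cotangent E x), α (B x β) = -β (B x α)

/-- A Poisson bivector: a bivector with `[P, P] = 0`. -/
structure IsPoisson (P : TensorField E M) : Prop extends IsBivector P where
  schouten_self : ∀ ξ₁ ξ₂ ξ₃ : OneForm E M, ξ₁.Smooth → ξ₂.Smooth → ξ₃.Smooth →
    ∀ x, schouten P P ξ₁ ξ₂ ξ₃ x = 0

/-- Two Poisson bivectors are compatible if any linear combination of them is Poisson. -/
def Compatible (P Q : TensorField E M) : Prop :=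
  ∀ a b : ℝ, IsPoisson (a • P + b • Q)

end

end PoissonGeometry

/-! ### Global smooth sections and smoothness of the basic operations. -/

namespace PoissonGeometry
open Bundle VectorField

noncomputable section

/-! By bilinearity and symmetry of the bracket, `P` and `Q` are compatible exactly when `[P, Q] =
0`. Everything then rests on one identity (`schouten_eq_lieTensor_sub_extDeriv`), which rewrites
`[H, K](θ, ξ, η)` as `ξ(L_{Kθ}H η) + ξ(L_{Hθ}K η) - dθ(Hη, Kξ) - dθ(Kη, Hξ)`.

Forward direction: take `θ = P⁻¹τ`, so `Pθ = τ` and `Qθ = Rτ`. With `H = K = P` the identity gives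
`dθ(Pη, Pξ) = μ ξ(Pη)`. Since every vector is `P` of a covector, both `dθ(Pη, Qξ)` and `dθ(Qη, Pξ)`
equal `μ ξ(Qη)`. With `H = P`, `K = Q`, the vanishing of the bracket becomes `L_{Rτ}P + νQ - 2μQ =
0`.

Converse: let `c = 2μ - ν ≠ 0` and `θ = P⁻¹Rτ`. The same identity for `[P, P] = 0` and `L_{Rτ}P =
cQ` shows that the two-form `P⁻¹QP⁻¹` is a constant multiple of `dθ`. For nondegenerate Poisson `P`,
the bracket `[P, Q]` is up to sign the exterior derivative of this two-form
(`IsPoisson.schouten_eq_of_nondegenerate`), so it vanishes because `d² = 0`. -/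

/-- Every vector in a fibre of a smooth vector bundle is the value of a global smooth section. -/
theorem exists_contMDiff_section_eq {E : Type*} [NormedAddCommGroup E] [NormedSpace ℝ E]
    [FiniteDimensional ℝ E] {M : Type*} [TopologicalSpace M] [T2Space M] [ChartedSpace E M]
    [IsManifold 𝓘(ℝ, E) ∞ M] (F : Type*) [NormedAddCommGroup F] [NormedSpace ℝ F]
    {V : M → Type*} [TopologicalSpace (TotalSpace F V)] [∀ x, AddCommGroup (V x)]
    [∀ x, Module ℝ (V x)] [∀ x, TopologicalSpace (V x)] [FiberBundle F V] [VectorBundle ℝ F V]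
    [ContMDiffVectorBundle ∞ F V 𝓘(ℝ, E)] {x : M} (v : V x) :
    ∃ s : Π y, V y, ContMDiff 𝓘(ℝ, E) (𝓘(ℝ, E).prod 𝓘(ℝ, F)) ∞ (T% s) ∧ s x = v := by
  obtain ⟨s, hs, hsm⟩ := FiberBundle.exists_contMDiffOn_extend (k := ∞) 𝓘(ℝ, E) F v
  obtain ⟨u, hus, hu, hxu⟩ := mem_nhds_iff.1 hs
  obtain ⟨f, -, hf⟩ := (SmoothBumpFunction.nhds_basis_tsupport (I := 𝓘(ℝ, E)) x).mem_iff.1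
    (hu.mem_nhds hxu)
  -- A bump function equal to 1 at `x`, supported where the local extension is smooth, makes the
  -- extension global.
  refine ⟨(f : M → ℝ) • FiberBundle.extend F v,
    ContMDiffOn.smul_section_of_tsupport f.contMDiff.contMDiffOn hu hf (hsm.mono hus), ?_⟩
  simp

variable {E : Type*} [NormedAddCommGroup E] [NormedSpace ℝ E]
  {M : Type*} [TopologicalSpace M] [ChartedSpace E M] [IsManifold 𝓘(ℝ, E) ∞ M]

theorem VecField.exists_smooth_eq [FiniteDimensional ℝ E] [T2Space M] {x : M}
    (v : TangentSpace 𝓘(ℝ, E) x) : ∃ X : VecField E M, X.Smooth ∧ X x = v :=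
  exists_contMDiff_section_eq E v

theorem OneForm.exists_smooth_eq [FiniteDimensional ℝ E] [T2Space M] {x : M}
    (α : Cotangent E x) : ∃ ξ : OneForm E M, ξ.Smooth ∧ ξ x = α :=
  exists_contMDiff_section_eq (V := fun x : M => TangentSpace 𝓘(ℝ, E) x →L[ℝ] ℝ) (E →L[ℝ] ℝ) α

theorem VecField.Smooth.mdifferentiableAt {X : VecField E M} (hX : X.Smooth) (x : M) :
    MDiffAt (T% X) x :=
  (hX x).mdifferentiableAt (by simp)

theorem VecField.Smooth.smul {f : M → ℝ} {X : VecField E M} (hf : ContMDiff 𝓘(ℝ, E) 𝓘(ℝ) ∞ f)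
    (hX : X.Smooth) : VecField.Smooth (f • X) :=
  ContMDiff.smul_section hf hX

theorem VecField.Smooth.mlieBracket [CompleteSpace E] {X Y : VecField E M} (hX : X.Smooth)
    (hY : Y.Smooth) : VecField.Smooth (mlieBracket 𝓘(ℝ, E) X Y) := by
  have : IsManifold 𝓘(ℝ, E) (((⊤ : ℕ∞) : ℕ∞ω) + 1) M := ‹IsManifold 𝓘(ℝ, E) ∞ M›
  have : IsManifold 𝓘(ℝ, E) (minSmoothness ℝ 2) M := by
    simpa using IsManifold.of_le (n := ∞) ENat.LEInfty.out
  exact ContDiff.mlieBracket_vectorField (n := ⊤) (m := ⊤) hX hY (by simp)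

theorem TensorField.Smooth.apply {B : TensorField E M} {ξ : OneForm E M} (hB : B.Smooth)
    (hξ : ξ.Smooth) : VecField.Smooth (fun x => B x (ξ x)) :=
  fun x => ContMDiffAt.clm_bundle_apply (hB x) (hξ x)

theorem OneForm.Smooth.apply {ξ : OneForm E M} {X : VecField E M} (hξ : ξ.Smooth) (hX : X.Smooth) :
    ContMDiff 𝓘(ℝ, E) 𝓘(ℝ) ∞ (fun x => ξ x (X x)) := by
  intro x
  have := ContMDiffAt.clm_bundle_apply (E₂ := fun _ : M => ℝ) (hξ x) (hX x)
  rw [contMDiffAt_totalSpace] at this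
  exact this.2

theorem contMDiff_mvfderiv_apply {f : M → ℝ} {X : VecField E M} (hf : ContMDiff 𝓘(ℝ, E) 𝓘(ℝ) ∞ f)
    (hX : X.Smooth) : ContMDiff 𝓘(ℝ, E) 𝓘(ℝ) ∞ (fun x => mvfderiv 𝓘(ℝ, E) f x (X x)) := by
  have : IsManifold 𝓘(ℝ, E) 1 M := .of_le (n := ∞) ENat.LEInfty.out
  have h := (hf.contMDiff_tangentMap (m := ∞) (by simp)).comp hX
  exact (contMDiff_snd_tangentBundle_modelSpace ℝ 𝓘(ℝ, ℝ)).comp h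

/-- The inverse of a smooth nondegenerate tensor field maps smooth vector fields to smooth
one-forms. -/
theorem OneForm.smooth_inverse_apply [FiniteDimensional ℝ E] {B : TensorField E M} (hB : B.Smooth)
    (hnd : Nondegenerate B) {X : VecField E M} (hX : X.Smooth) :
    OneForm.Smooth (fun x => (B x).inverse (X x)) := by
  have : CompleteSpace E := FiniteDimensional.complete ℝ E
  intro x₀
  refine ContMDiffAt.clm_bundle_apply (E₁ := fun x : M => TangentSpace 𝓘(ℝ, E) x)
    (E₂ := fun x : M => TangentSpace 𝓘(ℝ, E) x →L[ℝ] ℝ) (b := id)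
    (ϕ := fun x => (B x).inverse) ?_ (hX x₀)
  have h := hB x₀
  rw [contMDiffAt_hom_bundle] at h ⊢
  refine ⟨h.1, ?_⟩
  have h2 := h.2
  have hx₁ := mem_baseSet_trivializationAt E (fun x : M => TangentSpace 𝓘(ℝ, E) x) x₀
  have hx₂ := mem_baseSet_trivializationAt (E →L[ℝ] ℝ)
    (fun x : M => TangentSpace 𝓘(ℝ, E) x →L[ℝ] ℝ) x₀
  have key : (ContinuousLinearMap.inCoordinates (E →L[ℝ] ℝ)
      (fun x : M => TangentSpace 𝓘(ℝ, E) x →L[ℝ] ℝ) E (fun x : M => TangentSpace 𝓘(ℝ, E) x)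
      x₀ x₀ x₀ x₀ (B x₀)).IsInvertible := by
    rw [ContinuousLinearMap.inCoordinates_eq hx₂ hx₁]
    simpa using hnd.isInvertible x₀
  -- Operator inversion is smooth at an invertible operator; near `x₀` the inverse of the coordinate
  -- expression is the coordinate expression of the inverse.
  have h3 := (key.contDiffAt_map_inverse (n := ∞)).contMDiffAt.comp x₀ h2
  refine h3.congr_of_eventuallyEq ?_
  filter_upwards [(trivializationAt E (fun x : M => TangentSpace 𝓘(ℝ, E) x)
      x₀).open_baseSet.mem_nhds hx₁,
    (trivializationAt (E →L[ℝ] ℝ) (fun x : M => TangentSpace 𝓘(ℝ, E) x →L[ℝ] ℝ)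
      x₀).open_baseSet.mem_nhds hx₂] with x h1 h2
  simp only [Function.comp, id]
  rw [ContinuousLinearMap.inCoordinates_eq h1 h2, ContinuousLinearMap.inCoordinates_eq h2 h1]
  simp [ContinuousLinearMap.comp_assoc]

end
end PoissonGeometry

/-! ### The exterior derivative of a one-form and `d² = 0`. -/

namespace PoissonGeometry
open Bundle VectorField

noncomputable section

variable {E : Type*} [NormedAddCommGroup E] [NormedSpace ℝ E]
  {M : Type*} [TopologicalSpace M] [ChartedSpace E M]

/-- The exterior derivative of a one-form, evaluated on two vector fields. -/
def extDerivOneForm (θ : OneForm E M) (X Y : VecField E M) (x : M) : ℝ :=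
  mvfderiv 𝓘(ℝ, E) (fun y => θ y (Y y)) x (X x) - mvfderiv 𝓘(ℝ, E) (fun y => θ y (X y)) x (Y x)
    - θ x (mlieBracket 𝓘(ℝ, E) X Y x)

theorem extDerivOneForm_swap (θ : OneForm E M) (X Y : VecField E M) (x : M) :
    extDerivOneForm θ X Y x = -extDerivOneForm θ Y X x := by
  rw [extDerivOneForm, extDerivOneForm, mlieBracket_swap_apply]
  simp
  ring

variable [IsManifold 𝓘(ℝ, E) ∞ M] [FiniteDimensional ℝ E]

/-- The Jacobi identity for smooth vector fields. -/
theorem VecField.jacobi {X Y Z : VecField E M} (hX : X.Smooth) (hY : Y.Smooth)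
    (hZ : Z.Smooth) (x : M) :
    mlieBracket 𝓘(ℝ, E) X (mlieBracket 𝓘(ℝ, E) Y Z) x =
      mlieBracket 𝓘(ℝ, E) (mlieBracket 𝓘(ℝ, E) X Y) Z x +
        mlieBracket 𝓘(ℝ, E) Y (mlieBracket 𝓘(ℝ, E) X Z) x := by
  have : CompleteSpace E := FiniteDimensional.complete ℝ E
  have : IsManifold 𝓘(ℝ, E) (minSmoothness ℝ 3) M := by
    simpa using IsManifold.of_le (n := ∞) ENat.LEInfty.out
  have h2 : minSmoothness ℝ 2 ≤ ∞ := by simpa using ENat.LEInfty.out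
  exact leibniz_identity_mlieBracket_apply ((hX x).of_le h2) ((hY x).of_le h2) ((hZ x).of_le h2)

/-- The Lie bracket acts on functions as the commutator of derivations. -/
theorem mvfderiv_mlieBracket [T2Space M] {f : M → ℝ} {X Y : VecField E M}
    (hf : ContMDiff 𝓘(ℝ, E) 𝓘(ℝ) ∞ f) (hX : X.Smooth) (hY : Y.Smooth) (x : M) :
    mvfderiv 𝓘(ℝ, E) f x (mlieBracket 𝓘(ℝ, E) X Y x) =
      mvfderiv 𝓘(ℝ, E) (fun y => mvfderiv 𝓘(ℝ, E) f y (Y y)) x (X x)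
        - mvfderiv 𝓘(ℝ, E) (fun y => mvfderiv 𝓘(ℝ, E) f y (X y)) x (Y x) := by
  have : CompleteSpace E := FiniteDimensional.complete ℝ E
  have hmd : ∀ {g : M → ℝ}, ContMDiff 𝓘(ℝ, E) 𝓘(ℝ) ∞ g → ∀ y, MDiffAt g y :=
    fun hg y => (hg y).mdifferentiableAt (by simp)
  have h2 : IsManifold 𝓘(ℝ, E) 2 M := .of_le (n := ∞) ENat.LEInfty.out
  rcases subsingleton_or_nontrivial E with hE | hE
  · have h0 : ∀ v : TangentSpace 𝓘(ℝ, E) x, v = 0 := fun v => Subsingleton.elim (α := E) v 0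
    rw [h0 (mlieBracket 𝓘(ℝ, E) X Y x), h0 (X x), h0 (Y x)]
    simp
  · obtain ⟨e, he⟩ := exists_ne (0 : E)
    -- The Jacobi identity for `X`, `Y`, `f • Z`, minus `f` times the one for `X`, `Y`, `Z`, is the
    -- desired scalar identity multiplied by `Z x`; hence the choice `Z x ≠ 0`.
    obtain ⟨Z, hZ, hZx⟩ := VecField.exists_smooth_eq (x := x) (show TangentSpace 𝓘(ℝ, E) x from e)
    have hjac := VecField.jacobi hX hY (hZ.smul hf) x
    have hYf : mlieBracket 𝓘(ℝ, E) Y (f • Z) = (fun y => mvfderiv 𝓘(ℝ, E) f y (Y y)) • Z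
        + f • mlieBracket 𝓘(ℝ, E) Y Z :=
      funext fun y => mlieBracket_smul_right (hmd hf y) (hZ.mdifferentiableAt y)
    have hXf : mlieBracket 𝓘(ℝ, E) X (f • Z) = (fun y => mvfderiv 𝓘(ℝ, E) f y (X y)) • Z
        + f • mlieBracket 𝓘(ℝ, E) X Z :=
      funext fun y => mlieBracket_smul_right (hmd hf y) (hZ.mdifferentiableAt y)
    have hY' := contMDiff_mvfderiv_apply hf hY
    have hX' := contMDiff_mvfderiv_apply hf hX
    rw [hYf, hXf,
      mlieBracket_add_right ((hZ.smul hY').mdifferentiableAt x)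
        (((hY.mlieBracket hZ).smul hf).mdifferentiableAt x),
      mlieBracket_add_right ((hZ.smul hX').mdifferentiableAt x)
        (((hX.mlieBracket hZ).smul hf).mdifferentiableAt x),
      mlieBracket_smul_right (hmd hY' x) (hZ.mdifferentiableAt x),
      mlieBracket_smul_right (hmd hX' x) (hZ.mdifferentiableAt x),
      mlieBracket_smul_right (hmd hf x) ((hY.mlieBracket hZ).mdifferentiableAt x),
      mlieBracket_smul_right (hmd hf x) ((hX.mlieBracket hZ).mdifferentiableAt x),
      mlieBracket_smul_right (hmd hf x) (hZ.mdifferentiableAt x), VecField.jacobi hX hY hZ x,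
      hZx] at hjac
    have hne : (show TangentSpace 𝓘(ℝ, E) x from e) ≠ 0 := he
    rw [← sub_eq_zero]
    refine (smul_eq_zero.1 ?_).resolve_right hne
    rw [← sub_eq_zero] at hjac
    rw [← neg_eq_zero, ← hjac]
    module

/-- The exterior derivative of a one-form is closed. -/
theorem extDerivOneForm_closed [T2Space M] {θ : OneForm E M} {X Y Z : VecField E M}
    (hθ : θ.Smooth) (hX : X.Smooth) (hY : Y.Smooth) (hZ : Z.Smooth) (x : M) :
    mvfderiv 𝓘(ℝ, E) (extDerivOneForm θ Y Z) x (X x)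
      + mvfderiv 𝓘(ℝ, E) (extDerivOneForm θ Z X) x (Y x)
      + mvfderiv 𝓘(ℝ, E) (extDerivOneForm θ X Y) x (Z x)
      - extDerivOneForm θ (mlieBracket 𝓘(ℝ, E) X Y) Z x
      - extDerivOneForm θ (mlieBracket 𝓘(ℝ, E) Y Z) X x
      - extDerivOneForm θ (mlieBracket 𝓘(ℝ, E) Z X) Y x = 0 := by
  have : CompleteSpace E := FiniteDimensional.complete ℝ E
  have hmd : ∀ {g : M → ℝ}, ContMDiff 𝓘(ℝ, E) 𝓘(ℝ) ∞ g → ∀ y, MDiffAt g y :=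
    fun hg y => (hg y).mdifferentiableAt (by simp)
  have expand : ∀ {X Y : VecField E M}, X.Smooth → Y.Smooth → ∀ v : TangentSpace 𝓘(ℝ, E) x,
      mvfderiv 𝓘(ℝ, E) (extDerivOneForm θ X Y) x v =
        mvfderiv 𝓘(ℝ, E) (fun z => mvfderiv 𝓘(ℝ, E) (fun y => θ y (Y y)) z (X z)) x v
        - mvfderiv 𝓘(ℝ, E) (fun z => mvfderiv 𝓘(ℝ, E) (fun y => θ y (X y)) z (Y z)) x v
        - mvfderiv 𝓘(ℝ, E) (fun z => θ z (mlieBracket 𝓘(ℝ, E) X Y z)) x v := by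
    intro X Y hX hY v
    have h1 := hmd (contMDiff_mvfderiv_apply (hθ.apply hY) hX) x
    have h2 := hmd (contMDiff_mvfderiv_apply (hθ.apply hX) hY) x
    have h3 := hmd (hθ.apply (hX.mlieBracket hY)) x
    have := mvfderiv_fun_sub (h1.sub h2) h3
    have h4 := mvfderiv_fun_sub h1 h2
    unfold extDerivOneForm
    erw [this, h4]
    rfl
  rw [expand hY hZ, expand hZ hX, expand hX hY]
  simp only [extDerivOneForm]
  -- The second derivatives now cancel in pairs; the double brackets left inside `θ` cancel by
  -- Jacobi.
  rw [mvfderiv_mlieBracket (hθ.apply hZ) hX hY, mvfderiv_mlieBracket (hθ.apply hX) hY hZ,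
    mvfderiv_mlieBracket (hθ.apply hY) hZ hX]
  have hj := congrArg (θ x) (VecField.jacobi hX hY hZ x)
  have e1 := congrArg (θ x) (mlieBracket_swap_apply (I := 𝓘(ℝ, E))
    (V := mlieBracket 𝓘(ℝ, E) Y Z) (W := X) (x := x))
  have e2 := congrArg (θ x) (mlieBracket_swap_apply (I := 𝓘(ℝ, E))
    (V := mlieBracket 𝓘(ℝ, E) Z X) (W := Y) (x := x))
  have e3 : mlieBracket 𝓘(ℝ, E) Y (mlieBracket 𝓘(ℝ, E) Z X) x
      = - mlieBracket 𝓘(ℝ, E) Y (mlieBracket 𝓘(ℝ, E) X Z) x := by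
    rw [mlieBracket_swap (V := Z) (W := X)]
    have := mlieBracket_const_smul_right (V := Y) (c := (-1 : ℝ))
      ((hX.mlieBracket hZ).mdifferentiableAt x)
    simpa using this
  rw [e3] at e2
  simp only [map_add, map_neg] at hj e1 e2
  linarith

end
end PoissonGeometry

/-! ### Identities for the Schouten bracket. -/

namespace PoissonGeometry
open Bundle VectorField

noncomputable section

variable {E : Type*} [NormedAddCommGroup E] [NormedSpace ℝ E]
  {M : Type*} [TopologicalSpace M] [ChartedSpace E M]

/-- Nondegeneracy rules out the junk value 0 of `ContinuousLinearMap.inverse`. -/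
theorem Nondegenerate.apply_inverse [FiniteDimensional ℝ E] {P : TensorField E M}
    (hP : Nondegenerate P) (x : M) (v : TangentSpace 𝓘(ℝ, E) x) :
    P x ((P x).inverse v) = v :=
  (hP.isInvertible x).self_apply_inverse v

theorem eq_of_forall_cotangent {x : M} {v w : TangentSpace 𝓘(ℝ, E) x}
    (h : ∀ α : Cotangent E x, α v = α w) : v = w :=
  (SeparatingDual.eq_iff_forall_dual_eq (R := ℝ) (V := E)).2 h

variable [IsManifold 𝓘(ℝ, E) ∞ M]

theorem IsBivector.mvfderiv_swap {B : TensorField E M} (hB : IsBivector B) (ξ η : OneForm E M)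
    (x : M) (v : TangentSpace 𝓘(ℝ, E) x) :
    mvfderiv 𝓘(ℝ, E) (fun y => ξ y (B y (η y))) x v =
      -mvfderiv 𝓘(ℝ, E) (fun y => η y (B y (ξ y))) x v := by
  have h : (fun y => ξ y (B y (η y))) = -(fun y => η y (B y (ξ y))) :=
    funext fun y => hB.skew y _ _
  rw [h, mvfderiv_neg]
  simp

variable [FiniteDimensional ℝ E]

/-- Skew-symmetry moves `B` onto `η`, after which the defining formula of `L_X ξ` applies. This
turns Schouten brackets into derivatives of functions and Lie brackets of vector fields. -/
theorem IsBivector.pairing_lieOneForm {B : TensorField E M} (hB : IsBivector B)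
    (X : VecField E M) {ξ η : OneForm E M} (hξ : ξ.Smooth) (hη : η.Smooth) (x : M) :
    η x (B x (lieOneForm X ξ x)) = ξ x (mlieBracket 𝓘(ℝ, E) X (fun y => B y (η y)) x)
      - mvfderiv 𝓘(ℝ, E) (fun y => ξ y (B y (η y))) x (X x) := by
  rw [hB.skew, lieOneForm_apply X (hξ.diffAt x) (Y := fun y => B y (η y))
    ((hB.smooth.apply hη).mdifferentiableAt x)]
  ring

theorem IsBivector.pairing_lieTensor {B : TensorField E M} (hB : IsBivector B)
    (X : VecField E M) {ξ η : OneForm E M} (hξ : ξ.Smooth) (hη : η.Smooth) (x : M) :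
    ξ x (lieTensor X B x (η x)) = ξ x (mlieBracket 𝓘(ℝ, E) X (fun y => B y (η y)) x)
      - η x (mlieBracket 𝓘(ℝ, E) X (fun y => B y (ξ y)) x)
      - mvfderiv 𝓘(ℝ, E) (fun y => ξ y (B y (η y))) x (X x) := by
  rw [lieTensor_apply X (hB.smooth.diffAt x) (hη.diffAt x), map_sub,
    hB.pairing_lieOneForm X hη hξ, hB.mvfderiv_swap η ξ]
  ring

/-- The Schouten bracket with one argument `ξ₁` singled out, in terms of the Lie derivatives along
`K ξ₁` and `H ξ₁` and the exterior derivative of `ξ₁`. -/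
theorem schouten_eq_lieTensor_sub_extDeriv {H K : TensorField E M} (hH : IsBivector H)
    (hK : IsBivector K) {ξ₁ ξ₂ ξ₃ : OneForm E M} (h₁ : ξ₁.Smooth) (h₂ : ξ₂.Smooth)
    (h₃ : ξ₃.Smooth) (x : M) :
    schouten H K ξ₁ ξ₂ ξ₃ x =
      ξ₂ x (lieTensor (fun y => K y (ξ₁ y)) H x (ξ₃ x))
      + ξ₂ x (lieTensor (fun y => H y (ξ₁ y)) K x (ξ₃ x))
      - extDerivOneForm ξ₁ (fun y => H y (ξ₃ y)) (fun y => K y (ξ₂ y)) x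
      - extDerivOneForm ξ₁ (fun y => K y (ξ₃ y)) (fun y => H y (ξ₂ y)) x := by
  simp only [schouten, schoutenAux, extDerivOneForm]
  rw [hH.pairing_lieTensor _ h₂ h₃, hK.pairing_lieTensor _ h₂ h₃,
    hH.pairing_lieOneForm _ h₂ h₃, hK.pairing_lieOneForm _ h₂ h₃,
    hH.pairing_lieOneForm _ h₃ h₁, hK.pairing_lieOneForm _ h₃ h₁,
    hH.pairing_lieOneForm _ h₁ h₂, hK.pairing_lieOneForm _ h₁ h₂,
    hH.mvfderiv_swap ξ₃ ξ₁, hK.mvfderiv_swap ξ₃ ξ₁,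
    mlieBracket_swap_apply (V := fun y => K y (ξ₂ y)) (W := fun y => H y (ξ₁ y)),
    mlieBracket_swap_apply (V := fun y => H y (ξ₂ y)) (W := fun y => K y (ξ₁ y))]
  simp only [map_neg]
  ring

theorem lieOneForm_smul_add_smul_left {X Y : VecField E M} {ξ : OneForm E M} (a b : ℝ)
    (hX : X.Smooth) (hY : Y.Smooth) (hξ : ξ.Smooth) (x : M) :
    lieOneForm (a • X + b • Y) ξ x = a • lieOneForm X ξ x + b • lieOneForm Y ξ x := by
  have h2 : IsManifold 𝓘(ℝ, E) 2 M := .of_le (n := ∞) ENat.LEInfty.out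
  have : CompleteSpace E := FiniteDimensional.complete ℝ E
  ext v
  have hZ : MDiffAt (T% (FiberBundle.extend E v : VecField E M)) x :=
    FiberBundle.mdifferentiableAt_extend ..
  have hv : (FiberBundle.extend E v : VecField E M) x = v := by simp
  rw [← hv]
  have haX : VecField.Smooth (a • X) := ContMDiff.const_smul_section hX
  have hbY : VecField.Smooth (b • Y) := ContMDiff.const_smul_section hY
  simp only [add_apply, smul_apply, lieOneForm_apply _ (hξ.diffAt x) hZ]
  rw [mlieBracket_add_left (haX.mdifferentiableAt x) (hbY.mdifferentiableAt x),
    mlieBracket_const_smul_left (hX.mdifferentiableAt x),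
    mlieBracket_const_smul_left (hY.mdifferentiableAt x)]
  simp
  ring

/-- The bracket is symmetric and bilinear over constants, since `L_X ξ` is real-linear in `X`. -/
theorem schouten_self_smul_add_smul {P Q : TensorField E M} (a b : ℝ) (hP : P.Smooth)
    (hQ : Q.Smooth) {ξ₁ ξ₂ ξ₃ : OneForm E M} (h₁ : ξ₁.Smooth) (h₂ : ξ₂.Smooth)
    (h₃ : ξ₃.Smooth) (x : M) :
    schouten (a • P + b • Q) (a • P + b • Q) ξ₁ ξ₂ ξ₃ x =
      a ^ 2 * schouten P P ξ₁ ξ₂ ξ₃ x + 2 * a * b * schouten P Q ξ₁ ξ₂ ξ₃ x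
        + b ^ 2 * schouten Q Q ξ₁ ξ₂ ξ₃ x := by
  have key : ∀ {ξ η : OneForm E M}, ξ.Smooth → η.Smooth →
      lieOneForm (fun y => (a • P + b • Q) y (ξ y)) η x =
        a • lieOneForm (fun y => P y (ξ y)) η x + b • lieOneForm (fun y => Q y (ξ y)) η x :=
    fun hξ hη => lieOneForm_smul_add_smul_left a b (hP.apply hξ) (hQ.apply hξ) hη x
  simp only [schouten, schoutenAux, key h₁ h₂, key h₂ h₃, key h₃ h₁]
  simp only [Pi.add_apply, Pi.smul_apply, add_apply, smul_apply, map_add, map_smul, smul_eq_mul]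
  ring

/-- Compatibility is the vanishing of the mixed Schouten bracket. -/
theorem compatible_iff_schouten_eq_zero {P Q : TensorField E M} (hP : IsPoisson P)
    (hQ : IsPoisson Q) :
    Compatible P Q ↔ ∀ ξ₁ ξ₂ ξ₃ : OneForm E M, ξ₁.Smooth → ξ₂.Smooth → ξ₃.Smooth →
      ∀ x, schouten P Q ξ₁ ξ₂ ξ₃ x = 0 := by
  constructor
  · intro h ξ₁ ξ₂ ξ₃ h₁ h₂ h₃ x
    -- The single combination `P + Q` already forces the mixed bracket to vanish.
    have h' := (h 1 1).schouten_self ξ₁ ξ₂ ξ₃ h₁ h₂ h₃ x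
    rw [schouten_self_smul_add_smul 1 1 hP.smooth hQ.smooth h₁ h₂ h₃,
      hP.schouten_self ξ₁ ξ₂ ξ₃ h₁ h₂ h₃, hQ.schouten_self ξ₁ ξ₂ ξ₃ h₁ h₂ h₃] at h'
    linarith
  · intro h a b
    refine ⟨⟨?_, fun x α β => ?_⟩, fun ξ₁ ξ₂ ξ₃ h₁ h₂ h₃ x => ?_⟩
    · exact ContMDiff.add_section (ContMDiff.const_smul_section hP.smooth)
        (ContMDiff.const_smul_section hQ.smooth)
    · simp only [Pi.add_apply, Pi.smul_apply, add_apply, smul_apply, map_add, map_smul,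
        smul_eq_mul, hP.skew x α β, hQ.skew x α β]
      ring
    · rw [schouten_self_smul_add_smul a b hP.smooth hQ.smooth h₁ h₂ h₃,
        hP.schouten_self ξ₁ ξ₂ ξ₃ h₁ h₂ h₃, hQ.schouten_self ξ₁ ξ₂ ξ₃ h₁ h₂ h₃,
        h ξ₁ ξ₂ ξ₃ h₁ h₂ h₃]
      ring

/-! ### The mixed bracket when `P` is nondegenerate. -/

/-- For nondegenerate Poisson `P`, the bracket `[P, Q]` is, up to sign, the exterior derivative
of the two-form `P⁻¹ Q P⁻¹`, evaluated on the vector fields `P ξᵢ`. -/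
theorem IsPoisson.schouten_eq_of_nondegenerate {P Q : TensorField E M} (hP : IsPoisson P)
    (hnd : Nondegenerate P) (hQ : IsBivector Q) {ξ₁ ξ₂ ξ₃ : OneForm E M} (h₁ : ξ₁.Smooth)
    (h₂ : ξ₂.Smooth) (h₃ : ξ₃.Smooth) (x : M) :
    schouten P Q ξ₁ ξ₂ ξ₃ x =
      mvfderiv 𝓘(ℝ, E) (fun y => ξ₂ y (Q y (ξ₃ y))) x (P x (ξ₁ x))
      + mvfderiv 𝓘(ℝ, E) (fun y => ξ₃ y (Q y (ξ₁ y))) x (P x (ξ₂ x))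
      + mvfderiv 𝓘(ℝ, E) (fun y => ξ₁ y (Q y (ξ₂ y))) x (P x (ξ₃ x))
      + (P x).inverse (Q x (ξ₁ x))
          (mlieBracket 𝓘(ℝ, E) (fun y => P y (ξ₂ y)) (fun y => P y (ξ₃ y)) x)
      + (P x).inverse (Q x (ξ₂ x))
          (mlieBracket 𝓘(ℝ, E) (fun y => P y (ξ₃ y)) (fun y => P y (ξ₁ y)) x)
      + (P x).inverse (Q x (ξ₃ x))
          (mlieBracket 𝓘(ℝ, E) (fun y => P y (ξ₁ y)) (fun y => P y (ξ₂ y)) x) := by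
  have hb := hP.toIsBivector
  -- This is `[P, P](ζ, η, σ) = 0` for `ζ = P⁻¹Qξ`. Its cyclic versions trade the brackets of
  -- `P`-fields with `Q`-fields for brackets of `P`-fields alone.
  have key : ∀ {ξ η σ : OneForm E M}, ξ.Smooth → η.Smooth → σ.Smooth →
      σ x (mlieBracket 𝓘(ℝ, E) (fun y => P y (η y)) (fun y => Q y (ξ y)) x)
        + η x (mlieBracket 𝓘(ℝ, E) (fun y => Q y (ξ y)) (fun y => P y (σ y)) x)
        - mvfderiv 𝓘(ℝ, E) (fun y => η y (P y (σ y))) x (Q x (ξ x))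
        - mvfderiv 𝓘(ℝ, E) (fun y => σ y (Q y (ξ y))) x (P x (η x))
        - mvfderiv 𝓘(ℝ, E) (fun y => ξ y (Q y (η y))) x (P x (σ x))
        - (P x).inverse (Q x (ξ x))
          (mlieBracket 𝓘(ℝ, E) (fun y => P y (η y)) (fun y => P y (σ y)) x) = 0 := by
    intro ξ η σ hξ hη hσ
    set ζ : OneForm E M := fun y => (P y).inverse (Q y (ξ y)) with hζ
    have hζs : ζ.Smooth := OneForm.smooth_inverse_apply hP.smooth hnd (hQ.smooth.apply hξ)
    have hPζ : (fun y => P y (ζ y)) = fun y => Q y (ξ y) :=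
      funext fun y => hnd.apply_inverse y _
    have hPζx : P x (ζ x) = Q x (ξ x) := hnd.apply_inverse x _
    have hζη : (fun y => ζ y (P y (η y))) = fun y => ξ y (Q y (η y)) := by
      funext y
      rw [hb.skew, hQ.skew y (ξ y)]
      exact congrArg (fun v => -η y v) (hnd.apply_inverse y _)
    have hσζ : (fun y => σ y (P y (ζ y))) = fun y => σ y (Q y (ξ y)) :=
      funext fun y => congrArg (σ y) (hnd.apply_inverse y _)
    have h := hP.schouten_self ζ η σ hζs hη hσ x
    simp only [schouten, schoutenAux] at h
    rw [hb.pairing_lieOneForm _ hη hσ, hb.pairing_lieOneForm _ hσ hζs,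
      hb.pairing_lieOneForm _ hζs hη, hPζ, hζη, hσζ, hPζx,
      mlieBracket_swap_apply (V := fun y => P y (σ y)) (W := fun y => P y (η y))] at h
    simp only [map_neg] at h
    linarith
  have k₁ := key h₁ h₂ h₃
  have k₂ := key h₂ h₃ h₁
  have k₃ := key h₃ h₁ h₂
  simp only [schouten, schoutenAux]
  rw [hb.pairing_lieOneForm _ h₂ h₃, hQ.pairing_lieOneForm _ h₂ h₃,
    hb.pairing_lieOneForm _ h₃ h₁, hQ.pairing_lieOneForm _ h₃ h₁,
    hb.pairing_lieOneForm _ h₁ h₂, hQ.pairing_lieOneForm _ h₁ h₂]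
  linarith

/-- If a Poisson bivector `P` is nondegenerate and the bivector `Q` is the Lie derivative of `P`
along a smooth vector field, then `[P, Q] = 0`. -/
theorem IsPoisson.schouten_eq_zero_of_lieTensor [T2Space M] {P Q : TensorField E M}
    (hP : IsPoisson P) (hnd : Nondegenerate P) (hQ : IsBivector Q) {X : VecField E M}
    (hX : X.Smooth) {c : ℝ} (hc : c ≠ 0) (hXP : lieTensor X P = c • Q) {ξ₁ ξ₂ ξ₃ : OneForm E M}
    (h₁ : ξ₁.Smooth) (h₂ : ξ₂.Smooth) (h₃ : ξ₃.Smooth) (x : M) :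
    schouten P Q ξ₁ ξ₂ ξ₃ x = 0 := by
  have : CompleteSpace E := FiniteDimensional.complete ℝ E
  have hb := hP.toIsBivector
  set θ : OneForm E M := fun y => (P y).inverse (X y) with hθdef
  have hθ : θ.Smooth := OneForm.smooth_inverse_apply hP.smooth hnd hX
  have hPθ : (fun y => P y (θ y)) = X := funext fun y => hnd.apply_inverse y _
  have hQd : ∀ {ξ η : OneForm E M}, ξ.Smooth → η.Smooth → ∀ y,
      ξ y (Q y (η y)) = -c⁻¹ * extDerivOneForm θ (fun z => P z (ξ z)) (fun z => P z (η z)) y := by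
    intro ξ η hξ hη y
    have h := hP.schouten_self θ ξ η hθ hξ hη y
    rw [schouten_eq_lieTensor_sub_extDeriv hb hb hθ hξ hη, hPθ, hXP,
      extDerivOneForm_swap θ (fun z => P z (η z))] at h
    simp only [Pi.smul_apply, smul_apply, map_smul, smul_eq_mul] at h
    field_simp
    linarith
  -- An arbitrary `Y` is allowed because it will be a bracket `[Pη, Pσ]`; it is written as `P(P⁻¹Y)`
  -- to apply `hQd`.
  have hζ : ∀ {ξ : OneForm E M} {Y : VecField E M}, ξ.Smooth → Y.Smooth →
      (P x).inverse (Q x (ξ x)) (Y x) =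
        c⁻¹ * extDerivOneForm θ Y (fun z => P z (ξ z)) x := by
    intro ξ Y hξ hY
    set η : OneForm E M := fun y => (P y).inverse (Y y) with hη
    have hηs : η.Smooth := OneForm.smooth_inverse_apply hP.smooth hnd hY
    have hPη : (fun y => P y (η y)) = Y := funext fun y => hnd.apply_inverse y _
    have h := hQd hξ hηs x
    rw [hPη, extDerivOneForm_swap] at h
    have h' : (P x).inverse (Q x (ξ x)) (Y x) = ξ x (Q x (η x)) := by
      rw [← hnd.apply_inverse x (Y x), hb.skew, hnd.apply_inverse, hQ.skew]
      simp [hη]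
    rw [h', h]
    ring
  have hd : ∀ {ξ η : OneForm E M}, ξ.Smooth → η.Smooth → ∀ v : TangentSpace 𝓘(ℝ, E) x,
      mvfderiv 𝓘(ℝ, E) (fun y => ξ y (Q y (η y))) x v = -c⁻¹ * mvfderiv 𝓘(ℝ, E)
        (extDerivOneForm θ (fun z => P z (ξ z)) (fun z => P z (η z))) x v := by
    intro ξ η hξ hη v
    have h : extDerivOneForm θ (fun z => P z (ξ z)) (fun z => P z (η z)) =
        fun y => -c * ξ y (Q y (η y)) := by
      funext y
      rw [hQd hξ hη y]
      field_simp
    have hm : MDiffAt (fun y => ξ y (Q y (η y))) x :=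
      ((hξ.apply (hQ.smooth.apply hη)) x).mdifferentiableAt (by simp)
    rw [h, mvfderiv_fun_mul mdifferentiableAt_const hm]
    simp [mvfderiv_const]
    field_simp
  have Y₁ := hP.smooth.apply h₁
  have Y₂ := hP.smooth.apply h₂
  have Y₃ := hP.smooth.apply h₃
  rw [hP.schouten_eq_of_nondegenerate hnd hQ h₁ h₂ h₃, hd h₂ h₃, hd h₃ h₁, hd h₁ h₂,
    hζ h₁ (Y₂.mlieBracket Y₃), hζ h₂ (Y₃.mlieBracket Y₁), hζ h₃ (Y₁.mlieBracket Y₂)]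
  linear_combination (-c⁻¹) * extDerivOneForm_closed hθ Y₁ Y₂ Y₃ x

/-- If `[P, Q] = 0` and `τ` is a conformal symmetry of `P` and `Q` with constants `μ` and `ν`, then
`L_{Rτ} P = (2μ - ν) Q`. -/
theorem IsPoisson.lieTensor_eq_of_schouten_eq_zero [T2Space M] {P Q : TensorField E M}
    (hP : IsPoisson P) (hnd : Nondegenerate P) (hQ : IsBivector Q)
    (hPQ : ∀ ξ₁ ξ₂ ξ₃ : OneForm E M, ξ₁.Smooth → ξ₂.Smooth → ξ₃.Smooth →
      ∀ x, schouten P Q ξ₁ ξ₂ ξ₃ x = 0)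
    {τ : VecField E M} (hτ : τ.Smooth) {μ ν : ℝ} (hτP : lieTensor τ P = μ • P)
    (hτQ : lieTensor τ Q = ν • Q) :
    lieTensor (fun x => recursionOperator P Q x (τ x)) P = (2 * μ - ν) • Q := by
  have hb := hP.toIsBivector
  set θ : OneForm E M := fun y => (P y).inverse (τ y) with hθdef
  have hθ : θ.Smooth := OneForm.smooth_inverse_apply hP.smooth hnd hτ
  have hPθ : (fun y => P y (θ y)) = τ := funext fun y => hnd.apply_inverse y _
  have hd : ∀ {ξ η : OneForm E M}, ξ.Smooth → η.Smooth → ∀ x,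
      extDerivOneForm θ (fun z => P z (η z)) (fun z => P z (ξ z)) x = μ * ξ x (P x (η x)) := by
    intro ξ η hξ hη x
    have h := hP.schouten_self θ ξ η hθ hξ hη x
    rw [schouten_eq_lieTensor_sub_extDeriv hb hb hθ hξ hη, hPθ, hτP] at h
    simp only [Pi.smul_apply, smul_apply, map_smul, smul_eq_mul] at h
    linarith
  funext x
  ext1 α
  refine eq_of_forall_cotangent fun β => ?_
  obtain ⟨η, hη, rfl⟩ := OneForm.exists_smooth_eq α
  obtain ⟨ξ, hξ, rfl⟩ := OneForm.exists_smooth_eq β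
  have hζ : ∀ {σ : OneForm E M}, σ.Smooth →
      OneForm.Smooth (fun y => (P y).inverse (Q y (σ y))) :=
    fun hσ => OneForm.smooth_inverse_apply hP.smooth hnd (hQ.smooth.apply hσ)
  have hPζ : ∀ σ : OneForm E M,
      (fun y => P y ((P y).inverse (Q y (σ y)))) = fun y => Q y (σ y) :=
    fun σ => funext fun y => hnd.apply_inverse y _
  -- Writing `Qξ = P(P⁻¹Qξ)`, and likewise for `η`, evaluates both mixed terms of `dθ` as `μ ξ(Qη)`.
  have d₁ := hd (hζ hξ) hη x
  have d₂ := hd hξ (hζ hη) x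
  rw [hPζ] at d₁ d₂
  rw [hb.skew, hnd.apply_inverse, hQ.skew] at d₁
  rw [hnd.apply_inverse] at d₂
  have h := hPQ θ ξ η hθ hξ hη x
  rw [schouten_eq_lieTensor_sub_extDeriv hb hQ hθ hξ hη, hPθ, hτQ, d₁, d₂] at h
  -- `Rτ = QP⁻¹τ = Qθ` by definition, so the remaining Lie derivative is the one along `Rτ`.
  have hR : (fun y => recursionOperator P Q y (τ y)) = fun y => Q y (θ y) := rfl
  rw [hR]
  simp only [Pi.smul_apply, smul_apply, map_smul, smul_eq_mul] at h ⊢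
  linarith

end
end PoissonGeometry

/-! ### The compatibility criterion. -/

theorem mainTheorem7 {E : Type*} [NormedAddCommGroup E] [NormedSpace ℝ E] [FiniteDimensional ℝ E]
    {M : Type*} [TopologicalSpace M] [T2Space M] [ChartedSpace E M] [IsManifold 𝓘(ℝ, E) ∞ M]
    (P Q : PoissonGeometry.TensorField E M)
    (hP : PoissonGeometry.IsPoisson P) (hQ : PoissonGeometry.IsPoisson Q)
    (hnd : PoissonGeometry.Nondegenerate P)
    (τ₀ : PoissonGeometry.VecField E M) (hτ₀ : τ₀.Smooth) (μ ν : ℝ)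
    (hτP : PoissonGeometry.lieTensor τ₀ P = μ • P)
    (hτQ : PoissonGeometry.lieTensor τ₀ Q = ν • Q)
    (hμν : μ ≠ ν / 2) :
    PoissonGeometry.Compatible P Q ↔
      PoissonGeometry.lieTensor (fun x => PoissonGeometry.recursionOperator P Q x (τ₀ x)) P =
        (2 * μ - ν) • Q := by
  rw [PoissonGeometry.compatible_iff_schouten_eq_zero hP hQ]
  constructor
  · intro h
    exact hP.lieTensor_eq_of_schouten_eq_zero hnd hQ.toIsBivector h hτ₀ hτP hτQ
  · intro h ξ₁ ξ₂ ξ₃ h₁ h₂ h₃ x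
    refine hP.schouten_eq_zero_of_lieTensor hnd hQ.toIsBivector ?_ ?_ h h₁ h₂ h₃ x
    · exact hQ.smooth.apply (PoissonGeometry.OneForm.smooth_inverse_apply hP.smooth hnd hτ₀)
    -- `μ ≠ ν / 2` says exactly that `2μ - ν` is invertible, so that `Q` can be recovered from
    -- `L_{Rτ₀}P`.
    · intro h0
      exact hμν (by linarith)
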